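/- Let $d$ be a natural number, and for $z=(x,\xi)\in\mathbb R^{2d}$ let $T_x f(t)=f(t-x)$, $M_\xi f(t)=e^{2\pi i\,\xi\cdot t}f(t)$ and $\pi(z)=M_\xi T_x$ on $L^2(\mathbb R^d)$; put $\rho(x,\xi;\tau)=e^{2\pi i\tau}e^{-\pi i\,\xi\cdot x}\pi(x,\xi)$ for $\tau\in\mathbb R$. The same notation is used on $\mathbb R^{2d}$ in place of $\mathbb R^d$. Let $\mathcal A\in Sp(2d,\mathbb R)$ be a real symplectic $4d\times 4d$ matrix, and let $\widehat{\mathcal A}$ be a metaplectic operator with projection $\mathcal A$, that is, a unitary operator on $L^2(\mathbb R^{2d})$ such that $$\widehat{\mathcal A}\,\rho(\zeta;\tau)\,\widehat{\mathcal A}^{-1}=\rho(\mathcal A\zeta;\tau)\qquad(\zeta\in\mathbb R^{4d},\ \tau\in\mathbb R)$$ (this fixes $\widehat{\mathcal A}$ up to a factor of modulus one, and includes every element of the metaplectic group $Mp(2d,\mathbb R)$ lying over $\mathcal A$). For $f,g\in L^2(\mathbb R^d)$ define the metaplectic Wigner distribution $W_{\mathcal A}(f,g)=\widehat{\mathcal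 A}(f\otimes\overline g)\in L^2(\mathbb R^{2d})$, where $(f\otimes\overline g)(x,y)=f(x)\overline{g(y)}$, and the cross-Wigner distribution $$W(f,g)(x,\xi)=\int_{\mathbb R^d} f\big(x+\tfrac t2\big)\,\overline{g\big(x-\tfrac t2\big)}\,e^{-2\pi i\,t\cdot\xi}\,dt,\qquad (x,\xi)\in\mathbb R^{2d}.$$ For a function $h$ on $\mathbb R^{2d}$ put $h^*(t)=\overline{h(-t)}$. Assume that $W_{\mathcal A}$ is covariant: $W_{\mathcal A}(\pi(z)f,\pi(z)g)=T_zW_{\mathcal A}(f,g)$ for all $z\in\mathbb R^{2d}$ and $f,g\in L^2(\mathbb R^d)$. Then for all $f_1,g_1,f_2,g_2\in L^2(\mathbb R^d)$ the integrals defining the two convolutions below converge absolutely at every point of $\mathbb R^{2d}$, and at every point $$W_{\mathcal A}(f_1,g_1)*W_{\mathcal A}(f_2,g_2)^*=W(f_1,g_1)*W(f_2,g_2)^*.$$ -/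

import Mathlib

open MeasureTheory
open scoped ComplexConjugate InnerProductSpace ENNReal

noncomputable section

namespace TF

/-- `ℝⁿ`, with coordinates indexed by the finite type `ι`, with its Euclidean structure and its
Lebesgue measure `volume`. A point of `ℝ²ⁿ` has coordinates indexed by `ι ⊕ ι`. -/
abbrev Vec (ι : Type) [Fintype ι] : Type := EuclideanSpace ℝ ι

/-- The Hilbert space `L²(ℝⁿ)` of (classes of) complex-valued functions. -/
abbrev L2 (ι : Type) [Fintype ι] : Type := Lp ℂ 2 (volume : Measure (Vec ι))

section Basic

variable {ι : Type} [Fintype ι]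

/-- The first component `x` of `z = (x, ξ) ∈ ℝ²ⁿ`. -/
def pos (z : Vec (ι ⊕ ι)) : Vec ι := WithLp.toLp 2 (fun i => z (Sum.inl i))

/-- The second component `ξ` of `z = (x, ξ) ∈ ℝ²ⁿ`. -/
def freq (z : Vec (ι ⊕ ι)) : Vec ι := WithLp.toLp 2 (fun i => z (Sum.inr i))

theorem measurePreserving_pos_freq :
    MeasurePreserving (fun z : Vec (ι ⊕ ι) => (pos z, freq z)) volume (volume.prod volume) := by
  have h1 := EuclideanSpace.volume_preserving_symm_measurableEquiv_toLp (ι ⊕ ι)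
  have h2 := volume_measurePreserving_sumPiEquivProdPi (fun _ : ι ⊕ ι => ℝ)
  have h3 := (PiLp.volume_preserving_toLp ι).prod (PiLp.volume_preserving_toLp ι)
  exact (h3.comp (h2.comp h1) :)

theorem memLp_translate (x : Vec ι) (f : L2 ι) :
    MemLp (fun t => f (t - x)) 2 (volume : Measure (Vec ι)) :=
  (Lp.memLp f).comp_measurePreserving (measurePreserving_sub_right volume x)

/-- The translation operator `T_x f (t) = f (t - x)` on `L²(ℝⁿ)`. -/
def translate (x : Vec ι) (f : L2 ι) : L2 ι := (memLp_translate x f).toLp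

theorem memLp_modulate (ξ : Vec ι) (f : L2 ι) :
    MemLp (fun t => Complex.exp ((2 * Real.pi * ⟪ξ, t⟫_ℝ : ℝ) * Complex.I) * f t) 2
      (volume : Measure (Vec ι)) := by
  refine (Lp.memLp f).of_le ?_ (Filter.Eventually.of_forall fun t => ?_)
  · exact (Continuous.aestronglyMeasurable (by fun_prop)).mul (Lp.aestronglyMeasurable f)
  · rw [norm_mul, Complex.norm_exp_ofReal_mul_I, one_mul]

/-- The modulation operator `M_ξ f (t) = exp (2πi ξ·t) f (t)` on `L²(ℝⁿ)`. -/
def modulate (ξ : Vec ι) (f : L2 ι) : L2 ι := (memLp_modulate ξ f).toLp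

/-- The time-frequency shift `π(z) = M_ξ T_x` on `L²(ℝⁿ)`, where `z = (x, ξ)`. -/
def tfShift (z : Vec (ι ⊕ ι)) (f : L2 ι) : L2 ι := modulate (freq z) (translate (pos z) f)

/-- The Schrödinger representation `ρ(x, ξ; τ) = exp (2πiτ) exp (-πi ξ·x) π(x, ξ)` of the
Heisenberg group on `L²(ℝⁿ)`. -/
def schrodinger (z : Vec (ι ⊕ ι)) (τ : ℝ) (f : L2 ι) : L2 ι :=
  (Complex.exp ((2 * Real.pi * τ : ℝ) * Complex.I) *
    Complex.exp ((-(Real.pi * ⟪freq z, pos z⟫_ℝ) : ℝ) * Complex.I)) • tfShift z f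

/-- The unitary operator `U` of `L²(ℝⁿ)` is a metaplectic operator with projection the
symplectic matrix `A`, that is `U ρ(z; τ) U⁻¹ = ρ(A z; τ)` for all `z` and `τ`. This property
determines `U` up to a factor of modulus one; the two elements of the double cover `Mp(n, ℝ)`
of `Sp(n, ℝ)` that lie over `A` are two of these operators. -/
def IsMetaplectic [DecidableEq ι] (A : Matrix.symplecticGroup ι ℝ) (U : L2 ι ≃ₗᵢ[ℂ] L2 ι) :
    Prop :=
  ∀ (z : Vec (ι ⊕ ι)) (τ : ℝ) (f : L2 ι),
    U (schrodinger z τ (U.symm f)) =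
      schrodinger (WithLp.toLp 2 ((A : Matrix (ι ⊕ ι) (ι ⊕ ι) ℝ).mulVec z.ofLp)) τ f

theorem memLp_tensorConj (f g : L2 ι) :
    MemLp (fun u : Vec (ι ⊕ ι) => f (pos u) * conj (g (freq u))) 2 volume := by
  have hm : AEStronglyMeasurable (fun p : Vec ι × Vec ι => f p.1 * conj (g p.2))
      (volume.prod volume) :=
    (Lp.aestronglyMeasurable f).comp_fst.mul (Lp.aestronglyMeasurable g).star.comp_snd
  have h : MemLp (fun p : Vec ι × Vec ι => f p.1 * conj (g p.2)) 2 (volume.prod volume) := by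
    rw [memLp_two_iff_integrable_sq_norm hm]
    simpa only [norm_mul, RCLike.norm_conj, mul_pow] using
      ((memLp_two_iff_integrable_sq_norm (Lp.aestronglyMeasurable f)).1 (Lp.memLp f)).mul_prod
        ((memLp_two_iff_integrable_sq_norm (Lp.aestronglyMeasurable g)).1 (Lp.memLp g))
  exact h.comp_measurePreserving measurePreserving_pos_freq

/-- The tensor product `(f ⊗ ḡ)(x, y) = f(x) * conj (g(y))`, an element of `L²(ℝ²ⁿ)`. -/
def tensorConj (f g : L2 ι) : L2 (ι ⊕ ι) := (memLp_tensorConj f g).toLp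

/-- The metaplectic Wigner distribution `W_A(f, g) = U (f ⊗ ḡ)` of the metaplectic operator `U`
on `L²(ℝ²ⁿ)`. -/
def metaplecticWigner (U : L2 (ι ⊕ ι) ≃ₗᵢ[ℂ] L2 (ι ⊕ ι)) (f g : L2 ι) : L2 (ι ⊕ ι) :=
  U (tensorConj f g)

/-- Covariance: `W_A(π(z) f, π(z) g) = T_z W_A(f, g)` for all `z ∈ ℝ²ⁿ` and `f, g ∈ L²(ℝⁿ)`. -/
def IsCovariant (U : L2 (ι ⊕ ι) ≃ₗᵢ[ℂ] L2 (ι ⊕ ι)) : Prop :=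
  ∀ (z : Vec (ι ⊕ ι)) (f g : L2 ι),
    metaplecticWigner U (tfShift z f) (tfShift z g) = translate z (metaplecticWigner U f g)

/-- The cross-Wigner distribution
`W(f, g)(x, ξ) = ∫ f(x + t/2) * conj (g(x - t/2)) * exp (-2πi t·ξ) dt`. For `f, g ∈ L²(ℝⁿ)` the
integrand is integrable for every `(x, ξ)`. -/
def crossWigner (f g : L2 ι) (z : Vec (ι ⊕ ι)) : ℂ :=
  ∫ t : Vec ι, f (pos z + (1 / 2 : ℝ) • t) * conj (g (pos z - (1 / 2 : ℝ) • t)) *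
    Complex.exp ((-(2 * Real.pi * ⟪t, freq z⟫_ℝ) : ℝ) * Complex.I)

/-- The involution `h*(t) = conj (h(-t))`. -/
def involution (h : Vec ι → ℂ) (t : Vec ι) : ℂ := conj (h (-t))

end Basic

end TF

end

/-! ### Plancherel's theorem on `L¹ ∩ L²`. -/

section Plancherel

open scoped FourierTransform SchwartzMap

variable {E : Type*} [NormedAddCommGroup E] [InnerProductSpace ℝ E] [FiniteDimensional ℝ E]
  [MeasurableSpace E] [BorelSpace E]

/-! At a point `w`, the convolution `h₁ * h₂^*` is the `L²` inner product of `h₁` with the translate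
`T_w h₂`; it converges absolutely by Cauchy–Schwarz. If `h₂` is a covariant distribution of `(f₂,
g₂)`, then `T_w h₂` is the same distribution of `(π(w) f₂, π(w) g₂)`. If the distribution also
preserves inner products of tensors, the value is the inner product of `f₁ ⊗ ḡ₁` with `π(w) f₂ ⊗
conj (π(w) g₂)`, in which the distribution no longer appears. For `W_A` the two properties are the
assumed covariance and the unitarity of `U`. For the Wigner distribution they are
`crossWigner_tfShift` and Moyal's identity `integral_conj_crossWigner_mul_crossWigner`. Moyal's
identity is Plancherel in the variable `t` followed by a volume-preserving change of variables. -/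

/-- The Fourier integral of a function in `L¹ ∩ L²` represents its `L²` Fourier transform. -/
theorem fourier_toLp_ae_eq {F : E → ℂ} (h1 : Integrable F) (h2 : MemLp F 2) :
    (𝓕 (h2.toLp F) : Lp ℂ 2 (volume : Measure E)) =ᵐ[volume] 𝓕 F := by
  have hcont : Continuous (𝓕 F) :=
    VectorFourier.fourierIntegral_continuous Real.continuous_fourierChar
      (by exact continuous_inner) h1
  -- Both sides are tested against smooth compactly supported `g`. The transform moves onto `g` by
  -- the distributional definition on one side (`key`) and by Fubini on the other (`e3`).
  refine ae_eq_of_integral_contDiff_smul_eq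
    ((Lp.memLp _).locallyIntegrable (by norm_num)) hcont.locallyIntegrable fun g hg hc => ?_
  have hc' : HasCompactSupport (Complex.ofRealCLM ∘ g) := hc.comp_left rfl
  have hg' : ContDiff ℝ (⊤ : ℕ∞) (Complex.ofRealCLM ∘ g) := by fun_prop
  let φ : 𝓢(E, ℂ) := hc'.toSchwartzMap hg'
  have hφ : ∀ x, φ x = (g x : ℂ) := fun x => rfl
  have key := congrArg (fun T => T φ) (Lp.fourier_toTemperedDistribution_eq (h2.toLp F))
  simp only [TemperedDistribution.fourier_apply, Lp.toTemperedDistribution_apply] at key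
  have e1 : ∫ x, g x • (𝓕 (h2.toLp F) : Lp ℂ 2 (volume : Measure E)) x =
      ∫ x, φ x • (𝓕 (h2.toLp F) : Lp ℂ 2 (volume : Measure E)) x := by
    simp [hφ]
  have e2 : ∫ x, (𝓕 φ) x • (h2.toLp F) x = ∫ x, (𝓕 (φ : E → ℂ)) x • F x := by
    refine integral_congr_ae (h2.coeFn_toLp.mono fun x hx => ?_)
    simp only [hx, SchwartzMap.fourier_coe]
  have e3 := VectorFourier.integral_fourierIntegral_smul_eq_flip (L := innerₗ E)
    Real.continuous_fourierChar (by exact continuous_inner) (φ.integrable (μ := volume)) h1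
  rw [flip_innerₗ] at e3
  rw [e1, ← key, e2]
  refine e3.trans ?_
  simp only [hφ]
  rfl

theorem memLp_fourier {F : E → ℂ} (h1 : Integrable F) (h2 : MemLp F 2) : MemLp (𝓕 F) 2 :=
  (memLp_congr_ae (fourier_toLp_ae_eq h1 h2)).1 (Lp.memLp _)

/-- Plancherel's theorem for Fourier integrals of functions in `L¹ ∩ L²`. -/
theorem integral_conj_fourier_mul_fourier {F G : E → ℂ} (hF1 : Integrable F) (hF2 : MemLp F 2)
    (hG1 : Integrable G) (hG2 : MemLp G 2) :
    ∫ x, conj (𝓕 F x) * 𝓕 G x = ∫ x, conj (F x) * G x := by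
  have h := Lp.inner_fourier_eq (hF2.toLp F) (hG2.toLp G)
  rw [L2.inner_def, L2.inner_def] at h
  convert h using 1
  · refine integral_congr_ae ?_
    filter_upwards [fourier_toLp_ae_eq hF1 hF2, fourier_toLp_ae_eq hG1 hG2] with x hx hy
    rw [hx, hy, RCLike.inner_apply, mul_comm]
  · refine integral_congr_ae ?_
    filter_upwards [hF2.coeFn_toLp, hG2.coeFn_toLp] with x hx hy
    rw [hx, hy, RCLike.inner_apply, mul_comm]

/-! ### Plancherel in one of two variables. -/

variable {X : Type*} [MeasurableSpace X] {μ : Measure X} [SFinite μ]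

/-- The Fourier transform in the second variable. -/
noncomputable def partialFourier (K : X × E → ℂ) (p : X × E) : ℂ := 𝓕 (fun t => K (p.1, t)) p.2

theorem stronglyMeasurable_partialFourier {K : X × E → ℂ} (hK : StronglyMeasurable K) :
    StronglyMeasurable (partialFourier K) := by
  unfold partialFourier
  simp only [Real.fourier_eq']
  have h : StronglyMeasurable fun q : (X × E) × E =>
      Complex.exp (((-2 * Real.pi * ⟪q.2, q.1.2⟫_ℝ : ℝ) : ℂ) * Complex.I) • K (q.1.1, q.2) := by
    have he : StronglyMeasurable fun q : (X × E) × E =>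
        Complex.exp (((-2 * Real.pi * ⟪q.2, q.1.2⟫_ℝ : ℝ) : ℂ) * Complex.I) :=
      Measurable.stronglyMeasurable (by fun_prop)
    exact he.smul
      (hK.comp_measurable (g := fun q : (X × E) × E => (q.1.1, q.2)) (by fun_prop))
  exact h.integral_prod_right

theorem memLp_section {K : X × E → ℂ} (hK : StronglyMeasurable K)
    (hK2 : MemLp K 2 (μ.prod volume)) :
    ∀ᵐ x ∂μ, MemLp (fun t => K (x, t)) 2 := by
  filter_upwards [((memLp_two_iff_integrable_sq_norm hK.aestronglyMeasurable).1 hK2).prod_right_ae]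
    with x hx
  exact (memLp_two_iff_integrable_sq_norm
    (hK.comp_measurable measurable_prodMk_left).aestronglyMeasurable).2 hx

/-- By Tonelli it suffices that almost every fibre is square integrable with integrable squared
norm; Plancherel on the fibre preserves that norm. -/
theorem memLp_partialFourier {K : X × E → ℂ} (hK : StronglyMeasurable K)
    (hK1 : ∀ x, Integrable fun t => K (x, t)) (hK2 : MemLp K 2 (μ.prod volume)) :
    MemLp (partialFourier K) 2 (μ.prod volume) := by
  have hm := stronglyMeasurable_partialFourier hK
  have hi := (memLp_two_iff_integrable_sq_norm hK.aestronglyMeasurable).1 hK2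
  rw [memLp_two_iff_integrable_sq_norm hm.aestronglyMeasurable,
    integrable_prod_iff (f := fun p => ‖partialFourier K p‖ ^ 2)
      (hm.norm.pow 2).aestronglyMeasurable]
  constructor
  · filter_upwards [memLp_section hK hK2] with x hx
    have h := memLp_fourier (hK1 x) hx
    exact (memLp_two_iff_integrable_sq_norm h.1).1 h
  · refine hi.integral_norm_prod_left.congr ?_
    filter_upwards [memLp_section hK hK2] with x hx
    have h := integral_conj_fourier_mul_fourier (hK1 x) hx (hK1 x) hx
    simp only [RCLike.conj_mul] at h
    simp only [norm_pow, norm_norm]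
    have h' : ((∫ t, ‖𝓕 (fun t => K (x, t)) t‖ ^ 2 : ℝ) : ℂ) =
        ((∫ t, ‖K (x, t)‖ ^ 2 : ℝ) : ℂ) := by
      rw [← integral_complex_ofReal, ← integral_complex_ofReal]
      simpa using h
    exact (Complex.ofReal_injective h').symm

theorem MeasureTheory.MemLp.integrable_conj_mul {α : Type*} [MeasurableSpace α] {ν : Measure α}
    {F G : α → ℂ} (hF : MemLp F 2 ν) (hG : MemLp G 2 ν) :
    Integrable (fun x => conj (F x) * G x) ν :=
  hF.star.integrable_mul hG

theorem integral_conj_partialFourier_mul_partialFourier {K K' : X × E → ℂ}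
    (hK : StronglyMeasurable K) (hK1 : ∀ x, Integrable fun t => K (x, t))
    (hK2 : MemLp K 2 (μ.prod volume))
    (hK' : StronglyMeasurable K') (hK1' : ∀ x, Integrable fun t => K' (x, t))
    (hK2' : MemLp K' 2 (μ.prod volume)) :
    ∫ p, conj (partialFourier K p) * partialFourier K' p ∂(μ.prod volume) =
      ∫ p, conj (K p) * K' p ∂(μ.prod volume) := by
  rw [integral_prod _ ((memLp_partialFourier hK hK1 hK2).integrable_conj_mul
      (memLp_partialFourier hK' hK1' hK2')), integral_prod _ (hK2.integrable_conj_mul hK2')]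
  refine integral_congr_ae ?_
  filter_upwards [memLp_section hK hK2, memLp_section hK' hK2'] with x hx hx'
  exact integral_conj_fourier_mul_fourier (hK1 x) hx (hK1' x) hx'

end Plancherel


/-! ### The cross-Wigner distribution and Moyal's identity. -/

namespace TF

variable {ι : Type} [Fintype ι]

open scoped FourierTransform

/-- The product `f(x + t/2) * conj (g(x - t/2))` as a function of `(x, t)`. -/
noncomputable def wignerKernel (f g : L2 ι) (p : Vec ι × Vec ι) : ℂ :=
  f (p.1 + (1 / 2 : ℝ) • p.2) * conj (g (p.1 - (1 / 2 : ℝ) • p.2))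

theorem measurePreserving_add_half_sub_half :
    MeasurePreserving (fun p : Vec ι × Vec ι => (p.1 + (1 / 2 : ℝ) • p.2, p.1 - (1 / 2 : ℝ) • p.2))
      (volume.prod volume) (volume.prod volume) := by
  -- The map factors, up to swaps, as the shear `x ↦ x + t/2 = u` followed by `t ↦ u - t = x - t/2`;
  -- each preserves volume on fibres.
  have h1 : MeasurePreserving (fun p : Vec ι × Vec ι => (p.1, p.2 + (1 / 2 : ℝ) • p.1))
      (volume.prod volume) (volume.prod volume) :=
    (MeasurePreserving.id volume).skew_product (g := fun t x => x + (1 / 2 : ℝ) • t)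
      (by fun_prop) (Filter.Eventually.of_forall fun t => map_add_right_eq_self _ _)
  have h2 : MeasurePreserving (fun p : Vec ι × Vec ι => (p.1, p.1 - p.2))
      (volume.prod volume) (volume.prod volume) :=
    (MeasurePreserving.id volume).skew_product (g := fun u t => u - t)
      (by fun_prop) (Filter.Eventually.of_forall fun u => (Measure.measurePreserving_sub_left _ u).map_eq)
  have hs := Measure.measurePreserving_swap (μ := (volume : Measure (Vec ι)))
    (ν := (volume : Measure (Vec ι)))
  convert h2.comp (hs.comp (h1.comp hs)) using 1
  funext p
  simp only [Function.comp, Prod.fst_swap, Prod.snd_swap, Prod.swap_prod_mk, Prod.mk.injEq,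
    true_and]
  module

theorem memLp_mul_conj_prod (f g : L2 ι) :
    MemLp (fun p : Vec ι × Vec ι => f p.1 * conj (g p.2)) 2 (volume.prod volume) := by
  have hm : AEStronglyMeasurable (fun p : Vec ι × Vec ι => f p.1 * conj (g p.2))
      (volume.prod volume) :=
    (Lp.aestronglyMeasurable f).comp_fst.mul (Lp.aestronglyMeasurable g).star.comp_snd
  rw [memLp_two_iff_integrable_sq_norm hm]
  simpa only [norm_mul, RCLike.norm_conj, mul_pow] using
    ((memLp_two_iff_integrable_sq_norm (Lp.aestronglyMeasurable f)).1 (Lp.memLp f)).mul_prod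
      ((memLp_two_iff_integrable_sq_norm (Lp.aestronglyMeasurable g)).1 (Lp.memLp g))

theorem memLp_wignerKernel (f g : L2 ι) :
    MemLp (wignerKernel f g) 2 (volume.prod volume) := by
  have h := (memLp_mul_conj_prod f g).comp_measurePreserving measurePreserving_add_half_sub_half
  simp only [Function.comp_def] at h
  exact h

theorem stronglyMeasurable_wignerKernel (f g : L2 ι) : StronglyMeasurable (wignerKernel f g) := by
  have hf := (Lp.stronglyMeasurable f).comp_measurable
    (g := fun p : Vec ι × Vec ι => p.1 + (1 / 2 : ℝ) • p.2) (by fun_prop)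
  have hg := (Lp.stronglyMeasurable g).comp_measurable
    (g := fun p : Vec ι × Vec ι => p.1 - (1 / 2 : ℝ) • p.2) (by fun_prop)
  exact hf.mul hg.star

/-- Dilation multiplies Lebesgue measure by a constant, so null sets pull back to null sets. This
lets almost-everywhere identities be used along `t ↦ x ± t/2` for every fixed `x`. -/
theorem quasiMeasurePreserving_add_smul (x : Vec ι) {c : ℝ} (hc : c ≠ 0) :
    Measure.QuasiMeasurePreserving (fun t : Vec ι => x + c • t) volume volume := by
  refine (measurePreserving_add_left volume x).quasiMeasurePreserving.comp
    ⟨measurable_const_smul c, ?_⟩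
  rw [Measure.map_addHaar_smul _ hc]
  exact Measure.smul_absolutelyContinuous

theorem memLp_comp_add_smul (f : L2 ι) (x : Vec ι) {c : ℝ} (hc : c ≠ 0) :
    MemLp (fun t : Vec ι => f (x + c • t)) 2 := by
  have hm : AEStronglyMeasurable (fun t : Vec ι => f (x + c • t)) volume :=
    (Lp.aestronglyMeasurable f).comp_quasiMeasurePreserving (quasiMeasurePreserving_add_smul x hc)
  rw [memLp_two_iff_integrable_sq_norm hm]
  have h := (memLp_two_iff_integrable_sq_norm (Lp.aestronglyMeasurable f)).1 (Lp.memLp f)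
  exact (h.comp_add_left x).comp_smul hc

/-- Cauchy–Schwarz in `t`, valid at every `x` and not just almost every one. -/
theorem integrable_wignerKernel (f g : L2 ι) (x : Vec ι) :
    Integrable fun t => wignerKernel f g (x, t) := by
  have hf := memLp_comp_add_smul f x (c := 1 / 2) (by norm_num)
  have hg := memLp_comp_add_smul g x (c := -(1 / 2)) (by norm_num)
  have h : Integrable (fun t => f (x + (1 / 2 : ℝ) • t) * conj (g (x + (-(1 / 2) : ℝ) • t))) :=
    hf.integrable_mul hg.star
  simpa only [wignerKernel, neg_smul, ← sub_eq_add_neg] using h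

theorem crossWigner_eq_partialFourier (f g : L2 ι) (z : Vec (ι ⊕ ι)) :
    crossWigner f g z = partialFourier (wignerKernel f g) (pos z, freq z) := by
  simp only [crossWigner, partialFourier, Real.fourier_eq']
  refine integral_congr_ae (Filter.Eventually.of_forall fun t => ?_)
  simp only [wignerKernel, smul_eq_mul]
  rw [mul_comm]
  congr 4
  ring

theorem memLp_crossWigner (f g : L2 ι) : MemLp (crossWigner f g) 2 := by
  have h := (memLp_partialFourier (stronglyMeasurable_wignerKernel f g)
    (integrable_wignerKernel f g) (memLp_wignerKernel f g)).comp_measurePreserving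
      measurePreserving_pos_freq
  refine (memLp_congr_ae (Filter.Eventually.of_forall fun z => ?_)).1 h
  exact (crossWigner_eq_partialFourier f g z).symm

theorem inner_tensorConj (f₁ g₁ f₂ g₂ : L2 ι) :
    ⟪tensorConj f₂ g₂, tensorConj f₁ g₁⟫_ℂ =
      ∫ p : Vec ι × Vec ι, conj (f₂ p.1 * conj (g₂ p.2)) * (f₁ p.1 * conj (g₁ p.2))
        ∂(volume.prod volume) := by
  have hi := (memLp_mul_conj_prod f₂ g₂).integrable_conj_mul (memLp_mul_conj_prod f₁ g₁)
  rw [L2.inner_def, ← measurePreserving_pos_freq.map_eq, integral_map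
    measurePreserving_pos_freq.aemeasurable
    (by rw [measurePreserving_pos_freq.map_eq]; exact hi.aestronglyMeasurable)]
  refine integral_congr_ae ?_
  filter_upwards [(memLp_tensorConj f₁ g₁).coeFn_toLp, (memLp_tensorConj f₂ g₂).coeFn_toLp]
    with z h1 h2
  rw [tensorConj, tensorConj, h1, h2, RCLike.inner_apply, mul_comm]

/-- Moyal's identity. -/
theorem integral_conj_crossWigner_mul_crossWigner (f₁ g₁ f₂ g₂ : L2 ι) :
    ∫ z, conj (crossWigner f₂ g₂ z) * crossWigner f₁ g₁ z =
      ⟪tensorConj f₂ g₂, tensorConj f₁ g₁⟫_ℂ := by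
  have hW (f g : L2 ι) := memLp_partialFourier (stronglyMeasurable_wignerKernel f g)
    (integrable_wignerKernel f g) (memLp_wignerKernel f g)
  have hi := (hW f₂ g₂).integrable_conj_mul (hW f₁ g₁)
  have hi' := (memLp_mul_conj_prod f₂ g₂).integrable_conj_mul (memLp_mul_conj_prod f₁ g₁)
  calc
    _ = ∫ p : Vec ι × Vec ι, conj (partialFourier (wignerKernel f₂ g₂) p) *
          partialFourier (wignerKernel f₁ g₁) p ∂(volume.prod volume) := by
      rw [← measurePreserving_pos_freq.map_eq, integral_map
        measurePreserving_pos_freq.aemeasurable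
        (by rw [measurePreserving_pos_freq.map_eq]; exact hi.aestronglyMeasurable)]
      simp only [crossWigner_eq_partialFourier]
    _ = ∫ p : Vec ι × Vec ι, conj (wignerKernel f₂ g₂ p) * wignerKernel f₁ g₁ p
          ∂(volume.prod volume) :=
      integral_conj_partialFourier_mul_partialFourier (stronglyMeasurable_wignerKernel f₂ g₂)
        (integrable_wignerKernel f₂ g₂) (memLp_wignerKernel f₂ g₂)
        (stronglyMeasurable_wignerKernel f₁ g₁) (integrable_wignerKernel f₁ g₁)
        (memLp_wignerKernel f₁ g₁)
    _ = _ := by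
      -- The kernel is `f ⊗ ḡ` composed with this map.
      have hΦ := measurePreserving_add_half_sub_half (ι := ι)
      rw [inner_tensorConj]
      conv_rhs => rw [← hΦ.map_eq]
      rw [integral_map hΦ.aemeasurable
        (by rw [hΦ.map_eq]; exact hi'.aestronglyMeasurable)]
      rfl

/-! ### Covariance of the cross-Wigner distribution. -/

theorem coeFn_tfShift (z : Vec (ι ⊕ ι)) (f : L2 ι) :
    tfShift z f =ᵐ[volume] fun t =>
      Complex.exp ((2 * Real.pi * ⟪freq z, t⟫_ℝ : ℝ) * Complex.I) * f (t - pos z) := by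
  filter_upwards [(memLp_modulate (freq z) (translate (pos z) f)).coeFn_toLp,
    (memLp_translate (pos z) f).coeFn_toLp] with t h1 h2
  rw [tfShift, modulate, h1, translate, h2]

/-- Covariance of the cross-Wigner distribution. -/
theorem crossWigner_tfShift (w z : Vec (ι ⊕ ι)) (f g : L2 ι) :
    crossWigner (tfShift w f) (tfShift w g) z = crossWigner f g (z - w) := by
  refine integral_congr_ae ?_
  have hp := (quasiMeasurePreserving_add_smul (pos z) (c := 1 / 2) (by norm_num)).ae
    (coeFn_tfShift w f)
  have hm := (quasiMeasurePreserving_add_smul (pos z) (c := -(1 / 2)) (by norm_num)).ae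
    (coeFn_tfShift w g)
  filter_upwards [hp, hm] with t h1 h2
  rw [neg_smul, ← sub_eq_add_neg] at h2
  have e1 : pos (z - w) = pos z - pos w := rfl
  have e2 : freq (z - w) = freq z - freq w := rfl
  rw [h1, h2, e1, e2, add_sub_right_comm, sub_right_comm, map_mul, ← Complex.exp_conj, map_mul,
    Complex.conj_ofReal, Complex.conj_I]
  -- The two modulation phases differ by `freq w · ((x + t/2) - (x - t/2)) = freq w · t`, which
  -- shifts the frequency by `freq w`.
  have h3 : Complex.exp ((-(2 * Real.pi * ⟪t, freq z - freq w⟫_ℝ) : ℝ) * Complex.I) =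
      Complex.exp ((2 * Real.pi * ⟪freq w, pos z + (1 / 2 : ℝ) • t⟫_ℝ : ℝ) * Complex.I) *
      Complex.exp ((2 * Real.pi * ⟪freq w, pos z - (1 / 2 : ℝ) • t⟫_ℝ : ℝ) * -Complex.I) *
      Complex.exp ((-(2 * Real.pi * ⟪t, freq z⟫_ℝ) : ℝ) * Complex.I) := by
    rw [← Complex.exp_add, ← Complex.exp_add, inner_sub_right, inner_add_right, inner_sub_right,
      inner_smul_right, real_inner_comm t (freq w)]
    congr 1
    push_cast
    ring
  rw [h3]
  ring

/-! ### Convolutions as inner products with translates. -/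

variable {h₁ h₂ : Vec ι → ℂ}

theorem convolutionExists_involution (H₁ : MemLp h₁ 2) (H₂ : MemLp h₂ 2) :
    ConvolutionExists h₁ (involution h₂) (ContinuousLinearMap.mul ℂ ℂ) volume := by
  intro w
  have h : Integrable fun t => h₁ t * conj (h₂ (t - w)) :=
    H₁.integrable_mul (H₂.comp_measurePreserving (measurePreserving_sub_right volume w)).star
  simpa only [ConvolutionExistsAt, involution, neg_sub, ContinuousLinearMap.mul_apply'] using h

theorem convolution_involution_apply (w : Vec ι) :
    convolution h₁ (involution h₂) (ContinuousLinearMap.mul ℂ ℂ) volume w =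
      ∫ t, conj (h₂ (t - w)) * h₁ t := by
  simp only [convolution_def, involution, neg_sub, ContinuousLinearMap.mul_apply', mul_comm]

theorem convolution_crossWigner (f₁ g₁ f₂ g₂ : L2 ι) (w : Vec (ι ⊕ ι)) :
    convolution (crossWigner f₁ g₁) (involution (crossWigner f₂ g₂))
        (ContinuousLinearMap.mul ℂ ℂ) volume w =
      ⟪tensorConj (tfShift w f₂) (tfShift w g₂), tensorConj f₁ g₁⟫_ℂ := by
  simp only [convolution_involution_apply, ← crossWigner_tfShift,
    integral_conj_crossWigner_mul_crossWigner]

theorem convolution_metaplecticWigner {U : L2 (ι ⊕ ι) ≃ₗᵢ[ℂ] L2 (ι ⊕ ι)} (hU : IsCovariant U)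
    (f₁ g₁ f₂ g₂ : L2 ι) (w : Vec (ι ⊕ ι)) :
    convolution (metaplecticWigner U f₁ g₁) (involution (metaplecticWigner U f₂ g₂))
        (ContinuousLinearMap.mul ℂ ℂ) volume w =
      ⟪tensorConj (tfShift w f₂) (tfShift w g₂), tensorConj f₁ g₁⟫_ℂ := by
  -- Unitarity plays the role of Moyal's identity here.
  rw [← U.inner_map_map]
  change _ = ⟪metaplecticWigner U _ _, metaplecticWigner U _ _⟫_ℂ
  rw [hU, convolution_involution_apply, L2.inner_def]
  refine integral_congr_ae ?_
  filter_upwards [(memLp_translate w (metaplecticWigner U f₂ g₂)).coeFn_toLp] with t ht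
  rw [translate, ht, RCLike.inner_apply, mul_comm]

end TF

theorem lemma3 (d : ℕ) (A : Matrix.symplecticGroup (Fin d ⊕ Fin d) ℝ)
    (U : TF.L2 (Fin d ⊕ Fin d) ≃ₗᵢ[ℂ] TF.L2 (Fin d ⊕ Fin d))
    (hU : TF.IsMetaplectic A U) (hcov : TF.IsCovariant U)
    (f₁ g₁ f₂ g₂ : TF.L2 (Fin d)) :
    ConvolutionExists (TF.metaplecticWigner U f₁ g₁)
        (TF.involution (TF.metaplecticWigner U f₂ g₂)) (ContinuousLinearMap.mul ℂ ℂ) volume ∧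
      ConvolutionExists (TF.crossWigner f₁ g₁)
        (TF.involution (TF.crossWigner f₂ g₂)) (ContinuousLinearMap.mul ℂ ℂ) volume ∧
      convolution (TF.metaplecticWigner U f₁ g₁)
          (TF.involution (TF.metaplecticWigner U f₂ g₂)) (ContinuousLinearMap.mul ℂ ℂ) volume =
        convolution (TF.crossWigner f₁ g₁)
          (TF.involution (TF.crossWigner f₂ g₂)) (ContinuousLinearMap.mul ℂ ℂ) volume := by
  refine ⟨TF.convolutionExists_involution (Lp.memLp _) (Lp.memLp _),
    TF.convolutionExists_involution (TF.memLp_crossWigner _ _) (TF.memLp_crossWigner _ _), ?_⟩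
  funext w
  rw [TF.convolution_metaplecticWigner hcov, TF.convolution_crossWigner]
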